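/- Let $d,M\ge 1$, $\mathcal X=\mathbb R^d$ with its Borel $\sigma$-field, $\mathcal Y=\{1,\dots,M\}$ with its power set, and let $\mathcal P(\mathcal X\times\mathcal Y)$ be the set of probability measures on $\mathcal X\times\mathcal Y$. Let $\mathcal Q(\mathcal X)$ be the set of finite partitions $\pi=\{A_1,\dots,A_K\}$ of $\mathcal X$ into nonempty Borel sets. For each $\pi\in\mathcal Q(\mathcal X)$ fix points $\hat x_i\in A_i$ and let $\eta_\pi(x)=\sum_{i=1}^K \mathbf 1_{A_i}(x)\,\hat x_i$ be the associated vector quantizer. For random variables $U$ and $Y\in\mathcal Y$ put $I(U;Y)=H(Y)-H(Y|U)$, where $H(Y)=-\sum_{y}P(Y=y)\log P(Y=y)$ and $H(Y|U)=\int \bigl(-\sum_y P(Y=y|U=u)\log P(Y=y|U=u)\bigr)\,dP_U(u)$. For $(X,Y)\sim\mu\in\mathcal P(\mathcal X\times\mathcal Y)$ and $U=\eta_\pi(X)$ let $I(X;Y|\eta_\pi(X))=\int I_u(X;Y)\,dP_U(u)$, where $I_u(X;Y)$ is the mutual information of $X$ and $Y$ under the conditional law of $(X,Y)$ given $U=u$.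 Let $$\mathcal P_\pi(\mathcal X\times\mathcal Y)=\{\mu\in\mathcal P(\mathcal X\times\mathcal Y): I(X;Y)=I(\eta_\pi(X);Y)\text{ for }(X,Y)\sim\mu\},$$ and let $D(\cdot\|\cdot)$ be the Kullback--Leibler divergence. Then $$\max_{\mu\in\mathcal P(\mathcal X\times\mathcal Y)}\ \inf_{\tilde\mu\in\bigcup_{\pi\in\mathcal Q(\mathcal X)}\mathcal P_\pi(\mathcal X\times\mathcal Y)} D(\mu\|\tilde\mu)=0 ,$$ that is, the infimum is $0$ for every $\mu$. Moreover, for every $\mu\in\mathcal P(\mathcal X\times\mathcal Y)$ and $(X,Y)\sim\mu$, $$\inf_{\pi\in\mathcal Q(\mathcal X)} I(X;Y|\eta_\pi(X))=0 .$$ -/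

import Mathlib

open MeasureTheory ProbabilityTheory InformationTheory

noncomputable section

/-- The observation space `ℝ^d` with its Borel σ-field. -/
abbrev ObsSpace (d : ℕ) : Type := EuclideanSpace ℝ (Fin d)

/-- Shannon entropy `-∑ y, ν(y) log ν(y)` of a measure on the finite label set (`0 log 0 = 0`). -/
def shannonEntropy {M : ℕ} (ν : Measure (Fin M)) : ℝ :=
  ∑ y, Real.negMulLog (ν.real {y})

/-- Conditional entropy `H(Y|U) = ∫ H(ρ_{Y|U}(·|u)) dρ_U(u)`, where `ρ` is the law of `(U, Y)`. -/
def condEntropy {U : Type*} [MeasurableSpace U] {M : ℕ} [NeZero M]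
    (ρ : Measure (U × Fin M)) [IsFiniteMeasure ρ] : ℝ :=
  ∫ u, shannonEntropy (ρ.condKernel u) ∂ρ.fst

/-- Mutual information `I(U;Y) = H(Y) - H(Y|U)`, where `ρ` is the law of `(U, Y)`. -/
def mutualInfo {U : Type*} [MeasurableSpace U] {M : ℕ} [NeZero M]
    (ρ : Measure (U × Fin M)) [IsFiniteMeasure ρ] : ℝ :=
  shannonEntropy ρ.snd - condEntropy ρ

/-- The law of `(η(X), Y)` when `(X, Y)` has law `μ`. -/
def encodedLaw {d M : ℕ} {U : Type*} [MeasurableSpace U] (η : ObsSpace d → U)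
    (μ : ProbabilityMeasure (ObsSpace d × Fin M)) : Measure (U × Fin M) :=
  (μ : Measure (ObsSpace d × Fin M)).map (fun p => (η p.1, p.2))

instance {d M : ℕ} {U : Type*} [MeasurableSpace U] (η : ObsSpace d → U)
    (μ : ProbabilityMeasure (ObsSpace d × Fin M)) : IsFiniteMeasure (encodedLaw η μ) := by
  unfold encodedLaw; infer_instance

/-- The class of models for which the encoder `η` is information sufficient:
`I(X;Y) = I(η(X);Y)`. -/
def ISClass {d M : ℕ} [NeZero M] {U : Type*} [MeasurableSpace U] (η : ObsSpace d → U) :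
    Set (ProbabilityMeasure (ObsSpace d × Fin M)) :=
  {μ | mutualInfo (μ : Measure (ObsSpace d × Fin M)) = mutualInfo (encodedLaw η μ)}

/-- Conditional mutual information `I(X;Y|U) = ∫ I(μ_{X,Y|U}(·|u)) dμ_U(u)` with `U = η(X)`;
`μ_{X,Y|U}` is the regular conditional law of `(X, Y)` given `U`. -/
def condMutualInfo {d M : ℕ} [NeZero M] {U : Type*} [MeasurableSpace U] (η : ObsSpace d → U)
    (μ : ProbabilityMeasure (ObsSpace d × Fin M)) : ℝ :=
  ∫ u, mutualInfo (condDistrib (fun p : ObsSpace d × Fin M => p) (fun p => η p.1)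
      (μ : Measure (ObsSpace d × Fin M)) u)
    ∂((μ : Measure (ObsSpace d × Fin M)).map (fun p => η p.1))

/-- A finite measurable partition of `ℝ^d` into `size` nonempty cells. -/
structure FinMeasPartition (d : ℕ) where
  size : ℕ
  cell : Fin size → Set (ObsSpace d)
  measurableSet_cell : ∀ i, MeasurableSet (cell i)
  nonempty_cell : ∀ i, (cell i).Nonempty
  disjoint_cell : Pairwise fun i j => Disjoint (cell i) (cell j)
  iUnion_cell : ⋃ i, cell i = Set.univ

/-- The vector quantizer `x ↦ ∑ i, 1_{A_i}(x) • x̂_i` of a partition `π = {A_i}` with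
reproduction points `x̂_i`. -/
def vectorQuantizer {d : ℕ} (π : FinMeasPartition d) (rep : Fin π.size → ObsSpace d)
    (x : ObsSpace d) : ObsSpace d :=
  ∑ i, (π.cell i).indicator (fun _ => rep i) x

end

/-! Both claims come from quantizing x through its posterior label probabilities instead of its
position. Disintegrate μ into its marginal m and label kernel κ, and round each κ(x){y} down to the
grid of mesh 1/N. Only finitely many rounded vectors exist, so their fibres form an admissible
partition. For the divergence, replace κ by a kernel κ' that depends only on the rounded vector
(`gridKernel`). The model m ⊗ κ' is information sufficient for the quantizer, and κ ≤ (1 + M/N) κ',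
so the divergence is at most log(1 + M/N), which tends to 0. For the conditional information, κ
varies by at most 1/N in each coordinate on a cell, so uniform continuity of `negMulLog` makes the
information left inside each cell small (`mutualInfo_compProd_le`). -/

/-- If `μ ≤ C • ν`, then the divergence of `μ` from `ν` is at most `log C`. -/
lemma klDiv_le_log_of_le_smul {Ω : Type*} [MeasurableSpace Ω] {μ ν : Measure Ω}
    [IsProbabilityMeasure μ] [IsProbabilityMeasure ν] {C : ℝ} (hC : 1 ≤ C)
    (h : μ ≤ ENNReal.ofReal C • ν) :
    klDiv μ ν ≤ ENNReal.ofReal (Real.log C) := by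
  have hac : μ ≪ ν := Measure.absolutelyContinuous_of_le_smul h
  have hbound : ∀ᵐ x ∂ν, μ.rnDeriv ν x ≤ ENNReal.ofReal C := by
    refine ae_le_of_forall_setLIntegral_le_of_sigmaFinite (Measure.measurable_rnDeriv μ ν)
      fun s _ _ ↦ (Measure.setLIntegral_rnDeriv_le s).trans ?_
    simpa using h s
  have hint : Integrable (fun x ↦ (μ.rnDeriv ν x).toReal) ν := Measure.integrable_toReal_rnDeriv
  -- Here t log t ≤ t log C for a density value 0 < t ≤ C; at t = 0 both sides equal 1.
  have hpt : ∀ᵐ x ∂ν, klFun (μ.rnDeriv ν x).toReal ≤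
      (μ.rnDeriv ν x).toReal * Real.log C + 1 - (μ.rnDeriv ν x).toReal := by
    filter_upwards [hbound] with x hx
    have hx' : (μ.rnDeriv ν x).toReal ≤ C := ENNReal.toReal_le_of_le_ofReal (by linarith) hx
    have h0 : 0 ≤ (μ.rnDeriv ν x).toReal := ENNReal.toReal_nonneg
    rw [klFun_apply]
    rcases h0.eq_or_lt with h0 | h0
    · simp [← h0]
    · have := mul_le_mul_of_nonneg_left (Real.log_le_log h0 hx') h0.le
      linarith
  rw [klDiv_eq_lintegral_klFun_of_ac hac]
  calc ∫⁻ x, ENNReal.ofReal (klFun (μ.rnDeriv ν x).toReal) ∂ν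
      ≤ ∫⁻ x, ENNReal.ofReal
          ((μ.rnDeriv ν x).toReal * Real.log C + 1 - (μ.rnDeriv ν x).toReal) ∂ν :=
        lintegral_mono_ae (hpt.mono fun x hx ↦ ENNReal.ofReal_le_ofReal hx)
    _ = ENNReal.ofReal (∫ x,
          ((μ.rnDeriv ν x).toReal * Real.log C + 1 - (μ.rnDeriv ν x).toReal) ∂ν) := by
        refine (ofReal_integral_eq_lintegral_ofReal
          (((hint.mul_const _).add (integrable_const _)).sub hint) ?_).symm
        filter_upwards [hpt] with x hx
        exact (klFun_nonneg ENNReal.toReal_nonneg).trans hx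
    _ = ENNReal.ofReal (Real.log C) := by
        have hsum : Integrable (fun x ↦ (μ.rnDeriv ν x).toReal * Real.log C + 1) ν :=
          (hint.mul_const _).add (integrable_const _)
        rw [integral_sub hsum hint, integral_add (hint.mul_const _) (integrable_const _), integral_mul_const,
          Measure.integral_toReal_rnDeriv hac]
        simp

/-! ### Mutual information of a marginal and a label kernel -/

section Entropy

variable {U : Type*} [MeasurableSpace U] {M : ℕ}

lemma integrable_kernel_real (m : Measure U) [IsFiniteMeasure m] (κ : Kernel U (Fin M))
    [IsMarkovKernel κ] (s : Set (Fin M)) : Integrable (fun x ↦ (κ x).real s) m := by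
  refine Integrable.of_bound (C := 1)
    (κ.measurable_coe (MeasurableSet.of_discrete (s := s))).ennreal_toReal.aestronglyMeasurable
    (ae_of_all _ fun x ↦ ?_)
  rw [Real.norm_of_nonneg measureReal_nonneg]
  exact measureReal_le_one

lemma integrable_negMulLog_kernel_real (m : Measure U) [IsFiniteMeasure m]
    (κ : Kernel U (Fin M)) [IsMarkovKernel κ] (s : Set (Fin M)) :
    Integrable (fun x ↦ Real.negMulLog ((κ x).real s)) m := by
  refine Integrable.of_bound (C := 1)
    (Real.continuous_negMulLog.measurable.comp (κ.measurable_coe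
      (MeasurableSet.of_discrete (s := s))).ennreal_toReal).aestronglyMeasurable
    (ae_of_all _ fun x ↦ ?_)
  rw [Real.norm_of_nonneg (Real.negMulLog_nonneg measureReal_nonneg measureReal_le_one)]
  exact (Real.negMulLog_le_one_sub_self measureReal_nonneg).trans
    (by linarith [measureReal_nonneg (μ := κ x) (s := s)])

lemma snd_compProd_real (m : Measure U) [IsFiniteMeasure m] (κ : Kernel U (Fin M))
    [IsMarkovKernel κ] (s : Set (Fin M)) :
    (m ⊗ₘ κ).snd.real s = ∫ x, (κ x).real s ∂m := by
  have hs : MeasurableSet s := .of_discrete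
  rw [Measure.real, Measure.snd_compProd, Measure.bind_apply hs κ.aemeasurable]
  exact (integral_toReal (κ.measurable_coe hs).aemeasurable
    (ae_of_all _ fun x ↦ measure_lt_top _ _)).symm

/-- Disintegrations are a.e. unique, so κ may stand in for the chosen `condKernel`. -/
lemma condEntropy_compProd [NeZero M] (m : Measure U) [IsFiniteMeasure m]
    (κ : Kernel U (Fin M)) [IsMarkovKernel κ] :
    condEntropy (m ⊗ₘ κ) = ∫ x, shannonEntropy (κ x) ∂m := by
  have h := eq_condKernel_of_measure_eq_compProd κ (ρ := m ⊗ₘ κ) (by simp)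
  rw [Measure.fst_compProd] at h
  rw [condEntropy, Measure.fst_compProd]
  exact integral_congr_ae (h.mono fun x hx ↦ by simp only [hx])

lemma mutualInfo_compProd [NeZero M] (m : Measure U) [IsProbabilityMeasure m]
    (κ : Kernel U (Fin M)) [IsMarkovKernel κ] :
    mutualInfo (m ⊗ₘ κ) = ∑ y, (Real.negMulLog (∫ x, (κ x).real {y} ∂m) -
      ∫ x, Real.negMulLog ((κ x).real {y}) ∂m) := by
  simp only [mutualInfo, condEntropy_compProd, shannonEntropy]
  rw [integral_finsetSum _ fun y _ ↦ integrable_negMulLog_kernel_real m κ {y},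
    ← Finset.sum_sub_distrib]
  simp only [snd_compProd_real]

/-- Substitutes for rewriting ρ inside `mutualInfo`, whose instance argument depends on ρ. -/
lemma mutualInfo_congr [NeZero M] {ρ ρ' : Measure (U × Fin M)} [IsFiniteMeasure ρ]
    [IsFiniteMeasure ρ'] (h : ρ = ρ') : mutualInfo ρ = mutualInfo ρ' := by
  subst h; rfl

/-- Jensen's inequality for the concave `negMulLog`, label by label. -/
lemma mutualInfo_nonneg [NeZero M] (ρ : Measure (U × Fin M)) [IsProbabilityMeasure ρ] :
    0 ≤ mutualInfo ρ := by
  rw [mutualInfo_congr (ρ.disintegrate ρ.condKernel).symm, mutualInfo_compProd]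
  refine Finset.sum_nonneg fun y _ ↦ sub_nonneg.2 ?_
  exact Real.concaveOn_negMulLog.le_map_integral Real.continuous_negMulLog.continuousOn
    isClosed_Ici (ae_of_all _ fun x ↦ measureReal_nonneg)
    (integrable_kernel_real _ _ _) (integrable_negMulLog_kernel_real _ _ _)

/-- Mutual information is small when the conditional label probabilities take values in intervals
on which `negMulLog` has small oscillation. -/
lemma mutualInfo_compProd_le [NeZero M] (m : Measure U) [IsProbabilityMeasure m]
    (κ : Kernel U (Fin M)) [IsMarkovKernel κ] {δ ε : ℝ} (a : Fin M → ℝ)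
    (hδ : ∀ s ∈ Set.Icc (0 : ℝ) 1, ∀ t ∈ Set.Icc (0 : ℝ) 1, |s - t| ≤ δ →
      |Real.negMulLog s - Real.negMulLog t| ≤ ε)
    (ha : ∀ᵐ x ∂m, ∀ y, (κ x).real {y} ∈ Set.Icc (a y) (a y + δ)) :
    mutualInfo (m ⊗ₘ κ) ≤ M * ε := by
  rw [mutualInfo_compProd]
  have hterm : ∀ y, Real.negMulLog (∫ x, (κ x).real {y} ∂m) -
      ∫ x, Real.negMulLog ((κ x).real {y}) ∂m ≤ ε := by
    intro y
    -- By convexity the mean stays in the same interval of length δ as the values, so `hδ` compares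
    -- it with each of them.
    have hmean : ∫ x, (κ x).real {y} ∂m ∈ Set.Icc (a y) (a y + δ) :=
      (convex_Icc _ _).integral_mem isClosed_Icc (ha.mono fun x hx ↦ hx y)
        (integrable_kernel_real _ _ _)
    have hmean' : ∫ x, (κ x).real {y} ∂m ∈ Set.Icc (0 : ℝ) 1 :=
      (convex_Icc _ _).integral_mem isClosed_Icc
        (ae_of_all _ fun x ↦ ⟨measureReal_nonneg, measureReal_le_one⟩)
        (integrable_kernel_real _ _ _)
    have hle : Real.negMulLog (∫ x, (κ x).real {y} ∂m) - ε ≤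
        ∫ x, Real.negMulLog ((κ x).real {y}) ∂m := by
      calc Real.negMulLog (∫ x, (κ x).real {y} ∂m) - ε
          = ∫ _, (Real.negMulLog (∫ x, (κ x).real {y} ∂m) - ε) ∂m := by simp
        _ ≤ _ := by
          refine integral_mono_ae (integrable_const _)
            (integrable_negMulLog_kernel_real _ _ _) ?_
          filter_upwards [ha] with x hx
          have hx := hx y
          have := hδ _ hmean' _ ⟨measureReal_nonneg, measureReal_le_one⟩
            (abs_le.2 ⟨by linarith [hmean.1, hx.2], by linarith [hmean.2, hx.1]⟩)
          linarith [(abs_le.1 this).2]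
    linarith
  calc _ ≤ ∑ _y : Fin M, ε := Finset.sum_le_sum fun y _ ↦ hterm y
    _ = M * ε := by simp

end Entropy

/-! ### Quantizers and partitions into fibres -/

section Quantizer

variable {d : ℕ}

lemma vectorQuantizer_of_mem (π : FinMeasPartition d) (rep : Fin π.size → ObsSpace d)
    {i : Fin π.size} {x : ObsSpace d} (hx : x ∈ π.cell i) :
    vectorQuantizer π rep x = rep i := by
  rw [vectorQuantizer, Finset.sum_eq_single i, Set.indicator_of_mem hx]
  · intro j _ hj
    exact Set.indicator_of_notMem (Set.disjoint_left.1 (π.disjoint_cell hj.symm) hx) _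
  · simp

lemma FinMeasPartition.exists_mem_cell (π : FinMeasPartition d) (x : ObsSpace d) :
    ∃ i, x ∈ π.cell i := by
  simpa using π.iUnion_cell.ge (Set.mem_univ x)

lemma measurable_vectorQuantizer (π : FinMeasPartition d) (rep : Fin π.size → ObsSpace d) :
    Measurable (vectorQuantizer π rep) :=
  Finset.measurable_fun_sum _ fun i _ ↦ measurable_const.indicator (π.measurableSet_cell i)

lemma vectorQuantizer_preimage_rep (π : FinMeasPartition d) {rep : Fin π.size → ObsSpace d}
    (hrep : ∀ i, rep i ∈ π.cell i) (i : Fin π.size) :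
    vectorQuantizer π rep ⁻¹' {rep i} = π.cell i := by
  ext x
  refine ⟨fun h ↦ ?_, fun h ↦ vectorQuantizer_of_mem π rep h⟩
  obtain ⟨j, hj⟩ := π.exists_mem_cell x
  have h' : rep j = rep i := (vectorQuantizer_of_mem π rep hj).symm.trans h
  have hij : j = i := by
    by_contra hne
    exact Set.disjoint_left.1 (π.disjoint_cell hne) (hrep j) (h' ▸ hrep i)
  exact hij ▸ hj

/-- The partition of the observation space into the nonempty fibres of a measurable map to a
finite type. -/
noncomputable def fibrePartition {W : Type*} [Fintype W] [MeasurableSpace W]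
    [DiscreteMeasurableSpace W]
    (g : ObsSpace d → W) (hg : Measurable g) : FinMeasPartition d where
  size := Nat.card (Set.range g)
  cell i := g ⁻¹' {((Finite.equivFin (Set.range g)).symm i : W)}
  measurableSet_cell _ := hg .of_discrete
  nonempty_cell i := ((Finite.equivFin (Set.range g)).symm i).2
  disjoint_cell i j hij := by
    refine Disjoint.preimage _ (Set.disjoint_singleton.2 fun h ↦ hij ?_)
    exact (Finite.equivFin (Set.range g)).symm.injective (Subtype.ext h)
  iUnion_cell := by
    refine Set.eq_univ_of_forall fun x ↦ Set.mem_iUnion.2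
      ⟨Finite.equivFin (Set.range g) ⟨g x, x, rfl⟩, ?_⟩
    rw [Equiv.symm_apply_apply]
    rfl

lemma fibrePartition_vectorQuantizer {W : Type*} [Fintype W] [MeasurableSpace W]
    [DiscreteMeasurableSpace W] (g : ObsSpace d → W) (hg : Measurable g)
    {rep : Fin (fibrePartition g hg).size → ObsSpace d}
    (hrep : ∀ i, rep i ∈ (fibrePartition g hg).cell i) (x : ObsSpace d) :
    g (vectorQuantizer (fibrePartition g hg) rep x) = g x := by
  obtain ⟨i, hi⟩ := (fibrePartition g hg).exists_mem_cell x
  rw [vectorQuantizer_of_mem _ _ hi]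
  exact (hrep i).trans hi.symm

end Quantizer

/-! ### Conditioning on the quantizer output -/

lemma compProd_restrict_left_apply {U V : Type*} [MeasurableSpace U] [MeasurableSpace V]
    (m : Measure U) [SFinite m] (κ : Kernel U V) [IsSFiniteKernel κ] {A : Set U}
    (hA : MeasurableSet A) {s : Set (U × V)} (hs : MeasurableSet s) :
    (m.restrict A ⊗ₘ κ) s = (m ⊗ₘ κ) (Prod.fst ⁻¹' A ∩ s) := by
  rw [Measure.compProd_apply hs, Measure.compProd_apply ((measurable_fst hA).inter hs),
    ← lintegral_indicator hA]
  refine lintegral_congr fun x ↦ ?_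
  by_cases hx : x ∈ A
  · rw [Set.indicator_of_mem hx]
    congr 1
    ext y
    simp [hx]
  · rw [Set.indicator_of_notMem hx]
    have : Prod.mk x ⁻¹' (Prod.fst ⁻¹' A ∩ s) = ∅ := by
      ext y
      simp [hx]
    simp [this]

/-- On an atom `u` of the law of `f(X)`, the conditional law of `(X, Y)` given `f(X) = u` is the
law of `(X, Y)` conditioned on the fibre of `u`. -/
lemma condDistrib_id_eq_compProd {U V F : Type*} [MeasurableSpace U] [MeasurableSpace V]
    [MeasurableSpace F] [MeasurableSingletonClass F]
    [StandardBorelSpace U] [Nonempty U] [StandardBorelSpace V] [Nonempty V]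
    (μ : Measure (U × V)) [IsProbabilityMeasure μ] {f : U → F} (hf : Measurable f) {u : F}
    (hu : μ.map (fun p ↦ f p.1) {u} ≠ 0) :
    condDistrib (fun p : U × V ↦ p) (fun p ↦ f p.1) μ u =
      μ.fst[|f ⁻¹' {u}] ⊗ₘ μ.condKernel := by
  have hfu : MeasurableSet (f ⁻¹' {u}) := hf (measurableSet_singleton u)
  have hfm : Measurable fun p : U × V ↦ f p.1 := hf.comp measurable_fst
  ext s hs
  rw [condDistrib_apply_of_ne_zero measurable_id' u hu, ProbabilityTheory.cond,
    Measure.compProd_smul_left, Measure.smul_apply, compProd_restrict_left_apply _ _ hfu hs,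
    μ.disintegrate, Measure.fst_apply hfu,
    Measure.map_apply hfm (measurableSet_singleton u),
    Measure.map_apply (hfm.prodMk measurable_id') ((measurableSet_singleton u).prod hs),
    smul_eq_mul]
  rfl

/-- `condDistrib` is explicit only at atoms of positive mass. The output law is carried by finitely
many points, and those of mass zero form a null set. -/
lemma ae_map_vectorQuantizer {d M : ℕ} (π : FinMeasPartition d) (rep : Fin π.size → ObsSpace d)
    (μ : Measure (ObsSpace d × Fin M)) :
    ∀ᵐ u ∂(μ.map fun p ↦ vectorQuantizer π rep p.1),
      (∃ i, rep i = u) ∧ (μ.map fun p ↦ vectorQuantizer π rep p.1) {u} ≠ 0 := by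
  have hη : Measurable fun p : ObsSpace d × Fin M ↦ vectorQuantizer π rep p.1 :=
    (measurable_vectorQuantizer π rep).comp measurable_fst
  have hrange : ∀ᵐ u ∂(μ.map fun p ↦ vectorQuantizer π rep p.1), ∃ i, rep i = u := by
    refine (ae_map_iff hη.aemeasurable (Set.finite_range rep).measurableSet).2
      (ae_of_all _ fun p ↦ ?_)
    obtain ⟨i, hi⟩ := π.exists_mem_cell p.1
    exact ⟨i, (vectorQuantizer_of_mem π rep hi).symm⟩
  have hatom : ∀ᵐ u ∂(μ.map fun p ↦ vectorQuantizer π rep p.1), ∀ i, rep i = u →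
      (μ.map fun p ↦ vectorQuantizer π rep p.1) {u} ≠ 0 := by
    refine ae_all_iff.2 fun i ↦ ?_
    by_cases h : (μ.map fun p ↦ vectorQuantizer π rep p.1) {rep i} = 0
    · filter_upwards [compl_mem_ae_iff.2 h] with u hu hiu
      exact absurd hiu.symm hu
    · exact ae_of_all _ fun u hu ↦ hu ▸ h
  filter_upwards [hrange, hatom] with u ⟨i, hi⟩ hu
  exact ⟨⟨i, hi⟩, hu i hi⟩

section Quantizer

variable {d M : ℕ} [NeZero M]

lemma condMutualInfo_nonneg {F : Type*} [MeasurableSpace F] (η : ObsSpace d → F)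
    (μ : ProbabilityMeasure (ObsSpace d × Fin M)) : 0 ≤ condMutualInfo η μ :=
  integral_nonneg fun _ ↦ mutualInfo_nonneg _

/-- Conditioning on a cell changes the marginal of X but keeps the label kernel, so the oscillation
bound applies cell by cell. -/
lemma condMutualInfo_vectorQuantizer_le (π : FinMeasPartition d) {rep : Fin π.size → ObsSpace d}
    (hrep : ∀ i, rep i ∈ π.cell i) (μ : ProbabilityMeasure (ObsSpace d × Fin M)) {δ ε : ℝ}
    (hδ : ∀ s ∈ Set.Icc (0 : ℝ) 1, ∀ t ∈ Set.Icc (0 : ℝ) 1, |s - t| ≤ δ →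
      |Real.negMulLog s - Real.negMulLog t| ≤ ε)
    (a : Fin π.size → Fin M → ℝ)
    (ha : ∀ i, ∀ x ∈ π.cell i, ∀ y,
      ((μ : Measure (ObsSpace d × Fin M)).condKernel x).real {y} ∈ Set.Icc (a i y) (a i y + δ)) :
    condMutualInfo (vectorQuantizer π rep) μ ≤ M * ε := by
  have hη := measurable_vectorQuantizer π rep
  have hηm : Measurable fun p : ObsSpace d × Fin M ↦ vectorQuantizer π rep p.1 :=
    hη.comp measurable_fst
  have := Measure.isProbabilityMeasure_map (μ := (μ : Measure (ObsSpace d × Fin M)))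
    hηm.aemeasurable
  have hbound := ae_map_vectorQuantizer π rep (μ : Measure (ObsSpace d × Fin M))
  refine (integral_mono_of_nonneg (ae_of_all _ fun _ ↦ mutualInfo_nonneg _)
    (integrable_const (M * ε)) ?_).trans (by simp)
  filter_upwards [hbound] with u ⟨⟨i, hi⟩, hu⟩
  rw [mutualInfo_congr (condDistrib_id_eq_compProd _ hη hu)]
  subst hi
  rw [Measure.map_apply hηm (measurableSet_singleton _),
    show (fun p : ObsSpace d × Fin M ↦ vectorQuantizer π rep p.1) ⁻¹' {rep i} =
      Prod.fst ⁻¹' (vectorQuantizer π rep ⁻¹' {rep i}) from rfl,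
    ← Measure.fst_apply (hη (measurableSet_singleton _))] at hu
  have := cond_isProbabilityMeasure hu
  refine mutualInfo_compProd_le _ _ (a i) hδ ?_
  filter_upwards [ae_cond_mem (hη (measurableSet_singleton (rep i)))] with x hx
  rw [vectorQuantizer_preimage_rep π hrep] at hx
  exact ha i x hx

/-- A model whose label kernel is invariant under the encoder belongs to its information
sufficiency class. -/
lemma mem_ISClass_of_comp_eq {η : ObsSpace d → ObsSpace d} (hη : Measurable η)
    (ν : ProbabilityMeasure (ObsSpace d × Fin M)) (m : Measure (ObsSpace d))
    [IsProbabilityMeasure m] (κ : Kernel (ObsSpace d) (Fin M)) [IsMarkovKernel κ]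
    (hν : (ν : Measure (ObsSpace d × Fin M)) = m ⊗ₘ κ) (hκ : ∀ x, κ (η x) = κ x) :
    ν ∈ ISClass η := by
  have := Measure.isProbabilityMeasure_map (μ := m) hη.aemeasurable
  -- Invariance of κ under η lets the same kernel serve after encoding; only the marginal is pushed
  -- forward.
  have henc : encodedLaw η ν = m.map η ⊗ₘ κ := by
    have hmeas : Measurable fun p : ObsSpace d × Fin M ↦ (η p.1, p.2) := by fun_prop
    ext s hs
    rw [encodedLaw, hν, Measure.map_apply hmeas hs, Measure.compProd_apply (hmeas hs),
      Measure.compProd_apply hs, lintegral_map (Kernel.measurable_kernel_prodMk_left hs) hη]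
    refine lintegral_congr fun x ↦ ?_
    rw [hκ]
    rfl
  change mutualInfo _ = mutualInfo _
  rw [mutualInfo_congr hν, mutualInfo_congr henc, mutualInfo_compProd, mutualInfo_compProd]
  refine Finset.sum_congr rfl fun y _ ↦ ?_
  have hmeas : Measurable fun x ↦ (κ x).real {y} :=
    (κ.measurable_coe (measurableSet_singleton y)).ennreal_toReal
  have hmeas' : Measurable fun x ↦ Real.negMulLog ((κ x).real {y}) :=
    Real.continuous_negMulLog.measurable.comp hmeas
  rw [integral_map hη.aemeasurable hmeas.aestronglyMeasurable,
    integral_map hη.aemeasurable hmeas'.aestronglyMeasurable]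
  simp only [hκ]

end Quantizer

/-! ### Rounding the label kernel -/

section Discretization

variable {X : Type*} [MeasurableSpace X] {M : ℕ}

/-- The label probabilities of a kernel, rounded down to multiples of `1 / N`. -/
noncomputable def labelGrid (κ : Kernel X (Fin M)) (N : ℕ) (x : X) : Fin M → Fin (N + 1) :=
  fun y ↦ Fin.ofNat (N + 1) ⌊N * (κ x).real {y}⌋₊

lemma measurable_labelGrid (κ : Kernel X (Fin M)) (N : ℕ) : Measurable (labelGrid κ N) := by
  refine measurable_pi_iff.2 fun y ↦ (Measurable.of_discrete (f := Fin.ofNat (N + 1))).comp ?_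
  exact Nat.measurable_floor.comp
    ((κ.measurable_coe (measurableSet_singleton y)).ennreal_toReal.const_mul _)

/-- Probabilities are at most 1, so the floor is at most N and `Fin.ofNat` never wraps around. -/
lemma labelGrid_val (κ : Kernel X (Fin M)) [IsMarkovKernel κ] (N : ℕ) (x : X) (y : Fin M) :
    (labelGrid κ N x y : ℕ) = ⌊N * (κ x).real {y}⌋₊ := by
  refine Nat.mod_eq_of_lt (Nat.lt_succ_of_le (Nat.floor_le_of_le ?_))
  exact mul_le_of_le_one_right (Nat.cast_nonneg N) measureReal_le_one

lemma labelGrid_le (κ : Kernel X (Fin M)) [IsMarkovKernel κ] (N : ℕ) (x : X) (y : Fin M) :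
    (labelGrid κ N x y : ℝ) ≤ N * (κ x).real {y} := by
  rw [labelGrid_val]
  exact Nat.floor_le (by positivity)

lemma lt_labelGrid_add_one (κ : Kernel X (Fin M)) [IsMarkovKernel κ] (N : ℕ) (x : X)
    (y : Fin M) : N * (κ x).real {y} < (labelGrid κ N x y : ℝ) + 1 := by
  rw [labelGrid_val]
  exact Nat.lt_floor_add_one _

variable [NeZero M]

/-- The label distribution with weights proportional to `w y + 1`. -/
noncomputable def gridPMF {N : ℕ} (w : Fin M → Fin (N + 1)) : PMF (Fin M) :=
  PMF.normalize (fun y ↦ ((w y : ℕ) + 1 : ENNReal))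
    (by simp)
    (by simp [tsum_fintype, ENNReal.sum_eq_top])

/-- The kernel giving each point the grid distribution of its rounded label probabilities. -/
noncomputable def gridKernel (κ : Kernel X (Fin M)) (N : ℕ) : Kernel X (Fin M) :=
  (Kernel.ofFunOfCountable fun w : Fin M → Fin (N + 1) ↦ (gridPMF w).toMeasure).comap
    (labelGrid κ N) (measurable_labelGrid κ N)

lemma gridKernel_apply (κ : Kernel X (Fin M)) (N : ℕ) (x : X) :
    gridKernel κ N x = (gridPMF (labelGrid κ N x)).toMeasure := rfl

instance (κ : Kernel X (Fin M)) (N : ℕ) : IsMarkovKernel (gridKernel κ N) :=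
  ⟨fun x ↦ by rw [gridKernel_apply]; infer_instance⟩

/-- With p = κ(x){y}, the weight ⌊Np⌋ + 1 exceeds Np, and the weights sum to at most N + M. The
normalized weight is thus at least Np/(N + M). The added 1 keeps every weight positive. -/
lemma kernel_le_smul_gridKernel (κ : Kernel X (Fin M)) [IsMarkovKernel κ] {N : ℕ} (hN : 0 < N)
    (x : X) : κ x ≤ ENNReal.ofReal (1 + M / N) • gridKernel κ N x := by
  have hN' : (0 : ℝ) < N := by exact_mod_cast hN
  have hpt : ∀ y, κ x {y} ≤ ENNReal.ofReal (1 + M / N) * gridKernel κ N x {y} := by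
    intro y
    set w := labelGrid κ N x
    have hsum : ∑ z, ((w z : ℕ) + 1 : ℝ) ≤ N + M := by
      have h1 : ∑ z, (κ x).real {z} = 1 := by
        rw [sum_measureReal_singleton]
        simp
      calc ∑ z, ((w z : ℕ) + 1 : ℝ) ≤ ∑ z, (N * (κ x).real {z} + 1) :=
            Finset.sum_le_sum fun z _ ↦ by linarith [labelGrid_le κ N x z]
        _ = N + M := by simp [Finset.sum_add_distrib, ← Finset.mul_sum, h1]
    have hpos : 0 < ∑ z, ((w z : ℕ) + 1 : ℝ) :=
      Finset.sum_pos (fun z _ ↦ by positivity) Finset.univ_nonempty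
    have hgrid : gridKernel κ N x {y} =
        ENNReal.ofReal (((w y : ℕ) + 1) * (∑ z, ((w z : ℕ) + 1 : ℝ))⁻¹) := by
      rw [gridKernel_apply, PMF.toMeasure_apply_singleton _ _ (measurableSet_singleton y),
        gridPMF, PMF.normalize_apply, tsum_fintype, ENNReal.ofReal_mul (by positivity),
        ENNReal.ofReal_inv_of_pos hpos, ENNReal.ofReal_sum_of_nonneg (fun z _ ↦ by positivity)]
      simp [ENNReal.ofReal_add, w]
    rw [hgrid, ← ENNReal.ofReal_mul (by positivity), ← ofReal_measureReal]
    refine ENNReal.ofReal_le_ofReal ?_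
    have hlt := lt_labelGrid_add_one κ N x y
    have hy : (κ x).real {y} ≤ ((w y : ℕ) + 1) / N := by
      rw [le_div_iff₀ hN']
      linarith
    refine hy.trans ?_
    have : (1 + M / N : ℝ) * (((w y : ℕ) + 1) * (∑ z, ((w z : ℕ) + 1 : ℝ))⁻¹) =
        ((w y : ℕ) + 1) / N * ((N + M) / ∑ z, ((w z : ℕ) + 1 : ℝ)) := by
      field_simp
    rw [this]
    exact le_mul_of_one_le_right (by positivity) ((one_le_div hpos).2 hsum)
  refine Measure.le_iff.2 fun s hs ↦ ?_
  rw [← s.toFinite.coe_toFinset, ← sum_measure_singleton, ← sum_measure_singleton]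
  exact Finset.sum_le_sum fun y _ ↦ hpt y

end Discretization

lemma compProd_le_smul_compProd {U V : Type*} [MeasurableSpace U] [MeasurableSpace V]
    (m : Measure U) [SFinite m] {κ κ' : Kernel U V} [IsSFiniteKernel κ] [IsSFiniteKernel κ']
    {c : ENNReal} (h : ∀ x, κ x ≤ c • κ' x) : m ⊗ₘ κ ≤ c • (m ⊗ₘ κ') := by
  refine Measure.le_iff.2 fun s hs ↦ ?_
  rw [Measure.smul_apply, Measure.compProd_apply hs, Measure.compProd_apply hs, smul_eq_mul,
    ← lintegral_const_mul _ (Kernel.measurable_kernel_prodMk_left hs)]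
  exact lintegral_mono fun x ↦ h x _

/-! ### Approximation by information sufficient models and fine partitions -/

section Approximation

variable {d M : ℕ} [NeZero M]
  {rep : (π : FinMeasPartition d) → Fin π.size → ObsSpace d}

lemma exists_mem_ISClass_klDiv_le
    (hrep : ∀ (π : FinMeasPartition d) (i : Fin π.size), rep π i ∈ π.cell i)
    (μ : ProbabilityMeasure (ObsSpace d × Fin M)) {N : ℕ} (hN : 0 < N) :
    ∃ ν ∈ ⋃ π : FinMeasPartition d, (ISClass (vectorQuantizer π (rep π)) :
        Set (ProbabilityMeasure (ObsSpace d × Fin M))),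
      klDiv (μ : Measure (ObsSpace d × Fin M)) (ν : Measure (ObsSpace d × Fin M)) ≤
        ENNReal.ofReal (Real.log (1 + M / N)) := by
  let m := (μ : Measure (ObsSpace d × Fin M)).fst
  let κ := (μ : Measure (ObsSpace d × Fin M)).condKernel
  let π := fibrePartition (labelGrid κ N) (measurable_labelGrid κ N)
  refine ⟨⟨m ⊗ₘ gridKernel κ N, inferInstance⟩, Set.mem_iUnion.2 ⟨π, ?_⟩, ?_⟩
  · refine mem_ISClass_of_comp_eq (measurable_vectorQuantizer _ _) _ m (gridKernel κ N) rfl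
      fun x ↦ ?_
    rw [gridKernel_apply, gridKernel_apply, fibrePartition_vectorQuantizer _ _ (hrep π)]
  · refine klDiv_le_log_of_le_smul (ν := m ⊗ₘ gridKernel κ N)
      (le_add_of_nonneg_right (by positivity)) ?_
    calc (μ : Measure (ObsSpace d × Fin M)) = m ⊗ₘ κ := (Measure.disintegrate _ _).symm
      _ ≤ _ := compProd_le_smul_compProd m (kernel_le_smul_gridKernel κ hN)

lemma exists_condMutualInfo_le
    (hrep : ∀ (π : FinMeasPartition d) (i : Fin π.size), rep π i ∈ π.cell i)
    (μ : ProbabilityMeasure (ObsSpace d × Fin M)) {ε : ℝ} (hε : 0 < ε) :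
    ∃ π : FinMeasPartition d, condMutualInfo (vectorQuantizer π (rep π)) μ ≤ M * ε := by
  obtain ⟨δ, hδ, h⟩ := Metric.uniformContinuousOn_iff_le.1
    ((isCompact_Icc (a := (0 : ℝ)) (b := 1)).uniformContinuousOn_of_continuous
      Real.continuous_negMulLog.continuousOn) ε hε
  obtain ⟨n, hn⟩ := exists_nat_one_div_lt hδ
  let κ := (μ : Measure (ObsSpace d × Fin M)).condKernel
  let g := labelGrid κ (n + 1)
  refine ⟨fibrePartition g (measurable_labelGrid κ (n + 1)),
    condMutualInfo_vectorQuantizer_le _ (hrep _) μ h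
      -- The rounded vector is constant on a cell, so its value at the representative gives the left
      -- endpoints; the mesh 1/(n + 1) is below δ.
      (fun i y ↦ (g (rep _ i) y : ℝ) / (n + 1)) fun i x hx y ↦ ?_⟩
  have hg : g (rep _ i) = g x := (hrep _ i).trans hx.symm
  have h1 := labelGrid_le κ (n + 1) x y
  have h2 := lt_labelGrid_add_one κ (n + 1) x y
  have hn0 : (0 : ℝ) < n + 1 := by positivity
  push_cast at h1 h2
  rw [hg]
  constructor
  · rw [div_le_iff₀ hn0]
    linarith
  · have : (κ x).real {y} ≤ (g x y : ℝ) / (n + 1) + 1 / (n + 1) := by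
      rw [← add_div, le_div_iff₀ hn0]
      linarith
    linarith

end Approximation

theorem lemma4 (d M : ℕ) (hd : 0 < d) [NeZero M]
    (rep : (π : FinMeasPartition d) → Fin π.size → ObsSpace d)
    (hrep : ∀ (π : FinMeasPartition d) (i : Fin π.size), rep π i ∈ π.cell i) :
    IsGreatest
      (Set.range fun μ : ProbabilityMeasure (ObsSpace d × Fin M) =>
        ⨅ ν ∈ ⋃ π : FinMeasPartition d,
            (ISClass (vectorQuantizer π (rep π)) :
              Set (ProbabilityMeasure (ObsSpace d × Fin M))),
          klDiv (μ : Measure (ObsSpace d × Fin M)) (ν : Measure (ObsSpace d × Fin M)))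
      0 ∧
    ∀ μ : ProbabilityMeasure (ObsSpace d × Fin M),
      IsGLB
        (Set.range fun π : FinMeasPartition d =>
          condMutualInfo (vectorQuantizer π (rep π)) μ)
        0 := by
  have hzero : ∀ μ : ProbabilityMeasure (ObsSpace d × Fin M),
      ⨅ ν ∈ ⋃ π : FinMeasPartition d, (ISClass (vectorQuantizer π (rep π)) :
          Set (ProbabilityMeasure (ObsSpace d × Fin M))),
        klDiv (μ : Measure (ObsSpace d × Fin M)) (ν : Measure (ObsSpace d × Fin M)) = 0 := by
    intro μ
    have hlim : Filter.Tendsto (fun N : ℕ ↦ ENNReal.ofReal (Real.log (1 + M / N)))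
        Filter.atTop (nhds 0) := by
      have h1 : Filter.Tendsto (fun N : ℕ ↦ (1 + M / N : ℝ)) Filter.atTop (nhds (1 + 0)) :=
        tendsto_const_nhds.add (tendsto_const_div_atTop_nhds_zero_nat _)
      have h2 := ENNReal.tendsto_ofReal (h1.log (by norm_num))
      simpa using h2
    refine le_antisymm (ge_of_tendsto hlim ?_) zero_le
    filter_upwards [Filter.eventually_gt_atTop 0] with N hN
    obtain ⟨ν, hν, hle⟩ := exists_mem_ISClass_klDiv_le hrep μ hN
    exact (iInf₂_le ν hν).trans hle
  -- Any model attains the maximum; the Dirac mass only shows that one exists.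
  refine ⟨⟨⟨⟨Measure.dirac (0, 0), inferInstance⟩, hzero _⟩, ?_⟩, fun μ ↦ ⟨?_, fun b hb ↦ ?_⟩⟩
  · rintro _ ⟨μ, rfl⟩
    exact (hzero μ).le
  · rintro _ ⟨π, rfl⟩
    exact condMutualInfo_nonneg _ μ
  · refine le_of_forall_pos_le_add fun ε hε ↦ ?_
    have hM : (0 : ℝ) < M := by exact_mod_cast Nat.pos_of_neZero M
    obtain ⟨π, hπ⟩ := exists_condMutualInfo_le hrep μ (div_pos hε hM)
    have := hb ⟨π, rfl⟩
    rw [mul_div_cancel₀ _ hM.ne'] at hπ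
    linarith
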